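/- All graphs are finite and simple. A graph $G$ is $k$-vertex-critical if its chromatic number satisfies $\chi(G)=k$ but $\chi(G-v)<k$ for every vertex $v\in V(G)$. For graphs $H_1,\dots,H_r$, a graph is $(H_1,\dots,H_r)$-free if it contains no induced subgraph isomorphic to any of $H_1,\dots,H_r$. Let $P_n$ denote the path on $n$ vertices, $G+H$ the disjoint union of $G$ and $H$, and $cG$ the disjoint union of $c$ copies of $G$; the co-gem is the graph $P_4+P_1$. Theorem. For all integers $k\ge 1$ and $c\ge 0$ there are, up to isomorphism, only finitely many $k$-vertex-critical $(\text{co-gem},\,P_5,\,P_3+cP_2)$-free graphs. -/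

import Mathlib

namespace VertexCritical

/-- `G` is `k`-vertex-critical: `χ(G) = k`, but `χ(G - v) < k` for every vertex `v`. -/
def IsVertexCritical {V : Type*} (G : SimpleGraph V) (k : ℕ) : Prop :=
  G.chromaticNumber = (k : ℕ∞) ∧
    ∀ v : V, (G.induce ({v}ᶜ : Set V)).chromaticNumber < (k : ℕ∞)

/-- `G` is `H`-free: no induced subgraph of `G` is isomorphic to `H`. -/
def IsFree {W V : Type*} (H : SimpleGraph W) (G : SimpleGraph V) : Prop :=
  ¬ H.IsIndContained G

/-- `n G`, the disjoint union of `n` copies of `G`; the copies are indexed by `Fin n`. -/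
def copies {V : Type*} (n : ℕ) (G : SimpleGraph V) : SimpleGraph (Fin n × V) where
  Adj p q := p.1 = q.1 ∧ G.Adj p.2 q.2
  symm := ⟨fun _ _ h => ⟨h.1.symm, h.2.symm⟩⟩
  loopless := ⟨fun p h => G.loopless.irrefl p.2 h.2⟩

/-- The path `P_n` on `n` vertices. -/
abbrev P (n : ℕ) : SimpleGraph (Fin n) := SimpleGraph.pathGraph n

/-- The co-gem `P_4 + P_1`. -/
def coGem : SimpleGraph (Fin 4 ⊕ Fin 1) := SimpleGraph.sum (P 4) (P 1)

/-- The graph `P_3 + c P_2`. -/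
def P3PlusCopiesP2 (c : ℕ) : SimpleGraph (Fin 3 ⊕ (Fin c × Fin 2)) :=
  SimpleGraph.sum (P 3) (copies c (P 2))

end VertexCritical

/-
A `k`-vertex-critical graph has no homomorphism to a proper induced subgraph, so it is undominated,
and it contains no `K_{k+1}`. Both properties, and the absence of a fixed finite induced subgraph,
pass to ultraproducts. If the graphs in question were not of bounded size, an ultraproduct would
therefore be an infinite undominated (co-gem, `P_5`, `P_3 + c P_2`)-free graph with bounded cliques.
No such graph exists.

By Ramsey's theorem it has an infinite independent sequence `s`. Either infinitely many private
neighbours of the terms of `s` give an infinite induced matching, or `s` and some independent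
sequence `z` span a half graph. In the second case start again from `z`: half graphs compose, so
repeated failure to find a matching produces arbitrarily large cliques, one vertex from each layer.

From an infinite family of pairwise anticomplete `K_p`s with `p ≥ 2` one gets such a family of
`K_{p+1}`s. By undominatedness of one clique by another, either infinitely many cliques have a
private vertex complete to them, or there are vertices that miss one clique and are complete to
almost all the others. The latter again form a half graph, which `P_3 + c P_2` excludes, since a
vertex with neighbours in two of the cliques is complete to all but `c + 2` of them. Iterating
contradicts the bound on cliques.
-/

namespace VertexCritical

open SimpleGraph Filter

section Ramsey

lemma exists_strictMono_of_forall_infinite {α : Type*} {R : α → ℕ → ℕ → Prop}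
    (h : ∀ T : Set ℕ, T.Infinite → ∃ i ∈ T, ∃ y, {j ∈ T | R y i j}.Infinite) :
    ∃ (φ : ℕ → ℕ) (y : ℕ → α), StrictMono φ ∧ ∀ s t, s < t → R (y s) (φ s) (φ t) := by
  obtain ⟨-, -, y₀, -⟩ := h _ Set.infinite_univ
  have : Nonempty α := ⟨y₀⟩
  choose! i hi y hy using h
  let next (T : Set ℕ) : Set ℕ := {j ∈ T | R (y T) (i T) j} \ Set.Iic (i T)
  let T (n : ℕ) : Set ℕ := next^[n] Set.univ
  have hT_succ (n : ℕ) : T (n + 1) = next (T n) := Function.iterate_succ_apply' _ _ _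
  have hT_infinite (n : ℕ) : (T n).Infinite := by
    induction n with
    | zero => exact Set.infinite_univ
    | succ n ih => exact hT_succ n ▸ (hy _ ih).sdiff (Set.finite_Iic _)
  have hT_antitone : Antitone T :=
    antitone_nat_of_succ_le fun n j hj => (hT_succ n ▸ hj : j ∈ next (T n)).1.1
  have hmem (s t : ℕ) (hst : s < t) : i (T t) ∈ next (T s) :=
    hT_succ s ▸ hT_antitone (Nat.succ_le_of_lt hst) (hi _ (hT_infinite t))
  exact ⟨fun t => i (T t), fun t => y (T t), fun s t hst => not_le.1 (hmem s t hst).2,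
    fun s t hst => (hmem s t hst).1.2⟩

lemma exists_strictMono_forall_lt_eq {κ : Type*} [Finite κ] (color : ℕ → ℕ → κ) :
    ∃ (φ : ℕ → ℕ) (b : κ), StrictMono φ ∧ ∀ s t, s < t → color (φ s) (φ t) = b := by
  obtain ⟨φ, b, hφ, hb⟩ := exists_strictMono_of_forall_infinite
      (R := fun b i j => color i j = b) fun T hT => by
    obtain ⟨i, hi⟩ := hT.nonempty
    refine ⟨i, hi, ?_⟩
    by_contra! hfin
    exact hT (.of_finite_fibers (color i) (Set.toFinite _) fun b _ => hfin b)
  obtain ⟨b₀, hb₀⟩ := Finite.exists_infinite_fiber b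
  rw [Set.infinite_coe_iff] at hb₀
  exact ⟨φ ∘ Nat.nth (· ∈ b ⁻¹' {b₀}), b₀, hφ.comp (Nat.nth_strictMono hb₀), fun s t hst =>
    (hb _ _ (Nat.nth_strictMono hb₀ hst)).trans (Nat.nth_mem_of_infinite hb₀ s)⟩

variable {V : Type*} {G : SimpleGraph V} {n : ℕ}

lemma not_cliqueFree_of_pairwise_adj {f : Fin n → V} (hf : Pairwise fun a b => G.Adj (f a) (f b)) :
    ¬ G.CliqueFree n :=
  IsContained.not_cliqueFree ⟨⟨f, fun h => hf h⟩, Hom.injective_of_top_hom _⟩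

lemma exists_strictMono_not_adj (hG : G.CliqueFree n) (v : ℕ → V) :
    ∃ φ : ℕ → ℕ, StrictMono φ ∧ ∀ s t, ¬ G.Adj (v (φ s)) (v (φ t)) := by
  obtain ⟨φ, b, hφ, hb⟩ := exists_strictMono_forall_lt_eq fun i j => G.Adj (v i) (v j)
  have hnb : ¬ b := fun hb' => not_cliqueFree_of_pairwise_adj (f := fun a : Fin n => v (φ a))
    (Pairwise.of_lt fun s t hst => (hb s t hst).mpr hb') hG
  refine ⟨φ, hφ, fun s t hst => hnb ?_⟩
  rcases lt_trichotomy s t with h | rfl | h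
  · exact hb s t h ▸ hst
  · exact (G.irrefl hst).elim
  · exact hb t s h ▸ hst.symm

end Ramsey

section ForbiddenSubgraphs

variable {V W W₁ W₂ : Type*} {G : SimpleGraph V}

lemma injective_of_adj_iff {H : SimpleGraph W} {f : W → V}
    (hf : ∀ a b, G.Adj (f a) (f b) ↔ H.Adj a b)
    (htwin : ∀ a b, (∀ c, H.Adj a c ↔ H.Adj b c) → a = b) : Function.Injective f :=
  fun a b hab => htwin a b fun c => by rw [← hf, ← hf, hab]

lemma sum_isIndContained {H₁ : SimpleGraph W₁} {H₂ : SimpleGraph W₂} (e₁ : H₁ ↪g G)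
    (e₂ : H₂ ↪g G) (hH₁ : ∀ a, ∃ b, H₁.Adj a b) (he : ∀ a b, ¬ G.Adj (e₁ a) (e₂ b)) :
    (H₁.sum H₂).IsIndContained G := by
  refine ⟨⟨⟨Sum.elim e₁ e₂, e₁.injective.sumElim e₂.injective fun a b hab => ?_⟩, ?_⟩⟩
  · obtain ⟨a', ha'⟩ := hH₁ a
    exact he a' b (hab ▸ e₁.map_adj_iff.2 ha'.symm)
  · rintro (a | a) (b | b)
    · simp
    · simpa using he a b
    · simpa [G.adj_comm] using he b a
    · simp

lemma IsFree.false_of_path_five (h : IsFree (P 5) G) {a b c d e : V} (hab : G.Adj a b)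
    (hbc : G.Adj b c) (hcd : G.Adj c d) (hde : G.Adj d e) (hac : ¬ G.Adj a c)
    (had : ¬ G.Adj a d) (hae : ¬ G.Adj a e) (hbd : ¬ G.Adj b d) (hbe : ¬ G.Adj b e)
    (hce : ¬ G.Adj c e) : False := by
  have hadj (i j) : G.Adj (![a, b, c, d, e] i) (![a, b, c, d, e] j) ↔ (P 5).Adj i j := by
    fin_cases i <;> fin_cases j <;> simp_all [pathGraph_adj, G.adj_comm]
  refine h ⟨⟨_, injective_of_adj_iff hadj ?_⟩, hadj _ _⟩
  simp only [pathGraph_adj]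
  decide

lemma IsFree.false_of_path_four_add_vertex (h : IsFree coGem G) {a b c d e : V} (hab : G.Adj a b)
    (hbc : G.Adj b c) (hcd : G.Adj c d) (hac : ¬ G.Adj a c) (had : ¬ G.Adj a d)
    (hbd : ¬ G.Adj b d) (hae : ¬ G.Adj a e) (hbe : ¬ G.Adj b e) (hce : ¬ G.Adj c e)
    (hde : ¬ G.Adj d e) : False := by
  have hadj (i j) : G.Adj (![a, b, c, d] i) (![a, b, c, d] j) ↔ (P 4).Adj i j := by
    fin_cases i <;> fin_cases j <;> simp_all [pathGraph_adj, G.adj_comm]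
  refine h (sum_isIndContained ⟨⟨_, injective_of_adj_iff hadj ?_⟩, hadj _ _⟩
    ⟨⟨![e], Function.injective_of_subsingleton _⟩, ?_⟩ ?_ ?_)
  · simp only [pathGraph_adj]
    decide
  · simp [Subsingleton.elim _ (0 : Fin 1)]
  · simp only [pathGraph_adj]
    decide
  · simp [Fin.forall_fin_succ, *]

variable {ι : Type*} {s : ι → V} {x y : V}

lemma IsFree.adj_of_crossing (h : IsFree (P 5) G) (hs : ∀ i j, ¬ G.Adj (s i) (s j)) {i j l : ι}
    (hxi : G.Adj x (s i)) (hyi : G.Adj y (s i)) (hxj : G.Adj x (s j)) (hyj : ¬ G.Adj y (s j))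
    (hxl : ¬ G.Adj x (s l)) (hyl : G.Adj y (s l)) : G.Adj x y := by
  by_contra hxy
  exact h.false_of_path_five hxj.symm hxi hyi.symm hyl (hs j i) (mt G.adj_symm hyj) (hs j l) hxy
    hxl (hs i l)

lemma IsFree.not_adj_of_private_neighbors (h : IsFree coGem G) (hs : ∀ i j, ¬ G.Adj (s i) (s j))
    {i j l : ι} (hxi : G.Adj x (s i)) (hyi : ¬ G.Adj y (s i)) (hxj : ¬ G.Adj x (s j))
    (hyj : G.Adj y (s j)) (hxl : ¬ G.Adj x (s l)) (hyl : ¬ G.Adj y (s l)) : ¬ G.Adj x y :=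
  fun hxy => h.false_of_path_four_add_vertex hxi.symm hxy hyj (mt G.adj_symm hyi) (hs i j) hxj
    (hs i l) hxl hyl (hs j l)

end ForbiddenSubgraphs

section CliqueFamilies

variable {V κ ι : Type*} {G : SimpleGraph V} {Q : κ → ι → V}

/-- The vertex sets `Q i` are pairwise anticomplete cliques of `G`, indexed by `i : κ` and each
with its vertices listed by `ι`. For `ι = Fin 2` this is an induced matching; for a subsingleton
`ι` it is an independent family, in which repetitions are allowed. -/
def IsCliqueFamily (G : SimpleGraph V) (Q : κ → ι → V) : Prop :=
  ∀ i j a b, G.Adj (Q i a) (Q j b) ↔ i = j ∧ a ≠ b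

lemma IsCliqueFamily.adj (hQ : IsCliqueFamily G Q) (i : κ) {a b : ι} (hab : a ≠ b) :
    G.Adj (Q i a) (Q i b) :=
  (hQ i i a b).2 ⟨rfl, hab⟩

lemma IsCliqueFamily.not_adj (hQ : IsCliqueFamily G Q) {i j : κ} (hij : i ≠ j) (a b : ι) :
    ¬ G.Adj (Q i a) (Q j b) :=
  fun h => hij ((hQ i j a b).1 h).1

lemma IsCliqueFamily.not_adj_transversal (hQ : IsCliqueFamily G Q) (a : κ → ι) (i j : κ) :
    ¬ G.Adj (Q i (a i)) (Q j (a j)) := by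
  rw [hQ]
  rintro ⟨rfl, h⟩
  exact h rfl

lemma IsCliqueFamily.comp {κ' ι' : Type*} (hQ : IsCliqueFamily G Q) {φ : κ' → κ} {ψ : ι' → ι}
    (hφ : Function.Injective φ) (hψ : Function.Injective ψ) :
    IsCliqueFamily G fun i a => Q (φ i) (ψ a) :=
  fun i j a b => by rw [hQ, hφ.eq_iff, hψ.ne_iff]

lemma IsCliqueFamily.ne [Nontrivial ι] (hQ : IsCliqueFamily G Q) {i j : κ} (hij : i ≠ j)
    (a b : ι) : Q i a ≠ Q j b := by
  obtain ⟨c, hc⟩ := exists_ne a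
  exact fun h => hQ.not_adj hij.symm b c (h ▸ hQ.adj i hc.symm)

lemma IsCliqueFamily.injective_uncurry [Nontrivial ι] (hQ : IsCliqueFamily G Q) :
    Function.Injective fun q : κ × ι => Q q.1 q.2 := by
  rintro ⟨i, a⟩ ⟨j, b⟩ h
  obtain rfl : i = j := not_not.1 fun hij => hQ.ne hij a b h
  obtain rfl : a = b := not_not.1 fun hab => (hQ.adj i hab).ne h
  rfl

lemma IsCliqueFamily.cons [Infinite κ] (hgem : IsFree coGem G) {p : ℕ}
    {Q : κ → Fin (p + 1) → V} (hQ : IsCliqueFamily G Q) {x : κ → V}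
    (hx : ∀ i j b, G.Adj (x i) (Q j b) ↔ i = j) :
    IsCliqueFamily G fun i => (Fin.cons (x i) (Q i) : Fin (p + 2) → V) := by
  classical
  have hxx (i j) : ¬ G.Adj (x i) (x j) := by
    rcases eq_or_ne i j with rfl | hij
    · exact G.irrefl
    obtain ⟨l, hl⟩ := Infinite.exists_notMem_finset {i, j}
    simp only [Finset.mem_insert, Finset.mem_singleton, not_or] at hl
    have hs := hQ.not_adj_transversal fun _ => 0
    exact hgem.not_adj_of_private_neighbors hs (i := i) (j := j) (l := l) ((hx _ _ _).2 rfl)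
      (mt (hx _ _ _).1 hij.symm) (mt (hx _ _ _).1 hij) ((hx _ _ _).2 rfl)
      (mt (hx _ _ _).1 (Ne.symm hl.1)) (mt (hx _ _ _).1 (Ne.symm hl.2))
  intro i j a b
  cases a using Fin.cases <;> cases b using Fin.cases
  · simp [hxx]
  · simp [hx, (Fin.succ_ne_zero _).symm]
  · simp [G.adj_comm (Q i _), hx, eq_comm]
  · simp [hQ i j]

lemma IsFree.encard_lt_of_isCliqueFamily {c : ℕ} (h : IsFree (P3PlusCopiesP2 c) G) [Nontrivial ι]
    (hQ : IsCliqueFamily G Q) {u v w : V} (huv : G.Adj u v) (hvw : G.Adj v w) (huw : ¬ G.Adj u w)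
    (hne : u ≠ w) :
    {l | ∀ a, ¬ G.Adj u (Q l a) ∧ ¬ G.Adj v (Q l a) ∧ ¬ G.Adj w (Q l a)}.encard < c := by
  by_contra! hc
  obtain ⟨T, hTS, hT⟩ := Set.exists_subset_encard_eq hc
  have : Finite T := Set.finite_coe_iff.2 (Set.finite_of_encard_eq_coe hT)
  let e : Fin c ≃ T := (Finite.equivFinOfCardEq <| by
    rw [Nat.card_coe_set_eq, Set.ncard, hT, ENat.toNat_natCast]).symm
  obtain ⟨a, b, hab⟩ := exists_pair_ne ι
  have hpath_injective : Function.Injective ![u, v, w] :=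
    Fin.cons_injective_iff.2 ⟨by simp [huv.ne, hne], by simp [hvw.ne]⟩
  have hpath (i j) : G.Adj (![u, v, w] i) (![u, v, w] j) ↔ (P 3).Adj i j := by
    fin_cases i <;> fin_cases j <;> simp_all [pathGraph_adj, G.adj_comm]
  have hpair : Function.Injective ![a, b] := by simp [hab]
  have hedge (i j : Fin 2) : i ≠ j ↔ (P 2).Adj i j := by
    fin_cases i <;> fin_cases j <;> simp [pathGraph_adj]
  have hR := hQ.comp (Subtype.val_injective.comp e.injective) hpair
  refine h (sum_isIndContained ⟨⟨_, hpath_injective⟩, hpath _ _⟩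
    (⟨⟨_, hR.injective_uncurry⟩, ?_⟩ : copies c (P 2) ↪g G) ?_ fun i q => ?_)
  · rintro ⟨i, i'⟩ ⟨j, j'⟩
    exact (hR i j i' j').trans (and_congr_right fun _ => hedge i' j')
  · simp only [pathGraph_adj]
    decide
  · obtain ⟨hu, hv, hw⟩ := hTS (e q.1).2 (![a, b] q.2)
    fin_cases i
    exacts [hu, hv, hw]

end CliqueFamilies

section Undominated

variable {V : Type*} {G : SimpleGraph V}

/-- `G` is undominated: given finite families `f` and `g` of vertices with disjoint ranges such that
`f a ↦ g a` preserves adjacency, some `f a` has a neighbour outside the range of `f` that is not a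
neighbour of `g a`. Otherwise `G` could be folded onto a proper subgraph by moving each `f a` to
`g a`. -/
def IsUndominated (G : SimpleGraph V) : Prop :=
  ∀ (ι : Type) [Finite ι] [Nonempty ι] (f g : ι → V), G.comap f ≤ G.comap g →
    (∀ a b, f a ≠ g b) → ∃ a, ∃ x ∉ Set.range f, G.Adj x (f a) ∧ ¬ G.Adj x (g a)

lemma IsUndominated.exists_adj_not_adj (h : IsUndominated G) {u v : V} (huv : u ≠ v) :
    ∃ x, G.Adj x u ∧ ¬ G.Adj x v := by
  obtain ⟨-, x, -, hx⟩ := h Unit (fun _ => u) (fun _ => v)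
    (fun a b hab => (G.irrefl hab).elim) fun _ _ => huv
  exact ⟨x, hx⟩

variable {k : ℕ}

lemma IsVertexCritical.surjective (h : IsVertexCritical G k) (r : G →g G) :
    Function.Surjective r := by
  intro v
  by_contra! hv
  let r' : G →g G.induce {v}ᶜ := ⟨fun u => ⟨r u, hv u⟩, fun hab => r.map_adj hab⟩
  exact (chromaticNumber_mono_of_hom r').not_gt (h.1 ▸ h.2 v)

lemma IsVertexCritical.isUndominated (h : IsVertexCritical G k) : IsUndominated G := by
  intro ι _ _ f g hfg hne
  by_contra! hcon
  have fold_mem (v : V) (hv : v ∈ Set.range f) : ∃ a, f a = v ∧ f.extend g id v = g a := by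
    classical
    exact ⟨hv.choose, hv.choose_spec, (Function.extend_def f g id v).trans (dif_pos hv)⟩
  have fold_notMem (v : V) (hv : v ∉ Set.range f) : f.extend g id v = v :=
    Function.extend_apply' _ _ _ hv
  have fold_adj {u v : V} (huv : G.Adj u v) : G.Adj (f.extend g id u) (f.extend g id v) := by
    by_cases hu : u ∈ Set.range f <;> by_cases hv : v ∈ Set.range f
    · obtain ⟨a, rfl, ha⟩ := fold_mem u hu
      obtain ⟨b, rfl, hb⟩ := fold_mem v hv
      rw [ha, hb]
      exact hfg huv
    · obtain ⟨a, rfl, ha⟩ := fold_mem u hu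
      rw [ha, fold_notMem v hv]
      exact (hcon a v hv huv.symm).symm
    · obtain ⟨b, rfl, hb⟩ := fold_mem v hv
      rw [hb, fold_notMem u hu]
      exact hcon b u hu huv
    · rwa [fold_notMem u hu, fold_notMem v hv]
  obtain ⟨a₀⟩ := ‹Nonempty ι›
  obtain ⟨v, hv⟩ := h.surjective ⟨f.extend g id, fold_adj⟩ (f a₀)
  change f.extend g id v = f a₀ at hv
  by_cases hvf : v ∈ Set.range f
  · obtain ⟨a, -, ha⟩ := fold_mem v hvf
    exact hne a₀ a (hv.symm.trans ha)
  · rw [fold_notMem v hvf] at hv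
    exact hvf ⟨a₀, hv.symm⟩

lemma IsVertexCritical.cliqueFree (h : IsVertexCritical G k) : G.CliqueFree (k + 1) :=
  (chromaticNumber_le_iff_colorable.1 h.1.le).cliqueFree (Nat.lt_succ_self k)

end Undominated

section InducedMatching

variable {V κ : Type*} {G : SimpleGraph V} {s : κ → V}

lemma exists_private_neighbor [Infinite κ] (hgem : IsFree coGem G) (hP5 : IsFree (P 5) G)
    (hU : IsUndominated G) (hs : Function.Injective s) (hind : ∀ i j, ¬ G.Adj (s i) (s j))
    (hfin : ∀ y i, ¬ G.Adj y (s i) → {j | G.Adj y (s j)}.Finite) (i : κ) :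
    ∃ x, ∀ j, G.Adj x (s j) ↔ j = i := by
  obtain ⟨j₀, hj₀⟩ := exists_ne i
  obtain ⟨x₀, hx₀, hx₀'⟩ := hU.exists_adj_not_adj (hs.ne hj₀.symm)
  obtain ⟨x, ⟨hxi, hx⟩, hmin⟩ := exists_minimalFor_of_wellFoundedLT
    (fun x => G.Adj x (s i) ∧ {j | G.Adj x (s j)}.Finite) (fun x => {j | G.Adj x (s j)}.ncard)
    ⟨x₀, hx₀, hfin x₀ j₀ hx₀'⟩
  refine ⟨x, fun j => ⟨fun hxj => ?_, fun h => h ▸ hxi⟩⟩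
  by_contra hji
  obtain ⟨w, hwi, hwj⟩ := hU.exists_adj_not_adj (hs.ne (Ne.symm hji))
  have hw := hfin w j hwj
  have hsub : {j | G.Adj w (s j)} ⊆ {j | G.Adj x (s j)} := by
    intro l hwl
    by_contra hxl
    obtain ⟨m, hm⟩ := (hx.union hw).infinite_compl.nonempty
    simp only [Set.mem_compl_iff, Set.mem_union, Set.mem_ofPred_eq, not_or] at hm
    exact hgem.not_adj_of_private_neighbors hind hxj hwj hxl hwl hm.1 hm.2
      (hP5.adj_of_crossing hind hxi hwi hxj hwj hxl hwl)
  have hlt : {j | G.Adj w (s j)}.ncard < {j | G.Adj x (s j)}.ncard :=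
    Set.ncard_lt_ncard ⟨hsub, fun h => hwj (h hxj)⟩ hx
  exact hlt.not_ge (hmin ⟨hwi, hw⟩ hlt.le)

lemma exists_isCliqueFamily_fin_two [Infinite κ] (hgem : IsFree coGem G) (hP5 : IsFree (P 5) G)
    (hU : IsUndominated G) (hs : Function.Injective s) (hind : ∀ i j, ¬ G.Adj (s i) (s j))
    (hfin : ∀ y i, ¬ G.Adj y (s i) → {j | G.Adj y (s j)}.Finite) :
    ∃ Q : κ → Fin 2 → V, IsCliqueFamily G Q := by
  choose x hx using exists_private_neighbor hgem hP5 hU hs hind hfin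
  have hQ : IsCliqueFamily G fun i (_ : Fin 1) => s i := fun i j a b => by
    simp [hind, Subsingleton.elim a b]
  exact ⟨_, hQ.cons hgem (x := x) fun i j _ => (hx i j).trans eq_comm⟩

end InducedMatching

section HalfGraphs

variable {V : Type*} {G : SimpleGraph V} {y z s : ℕ → V} {n : ℕ}

/-- The sequences `y` and `s` span a half graph: `y i` is adjacent to exactly the `s j` with
`i < j`. Adjacency inside each sequence is unrestricted. -/
def IsHalfGraph (G : SimpleGraph V) (y s : ℕ → V) : Prop :=
  ∀ i j, G.Adj (y i) (s j) ↔ i < j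

lemma IsHalfGraph.injective (h : IsHalfGraph G y s) : Function.Injective y :=
  fun i j hij => eq_of_forall_gt_iff fun l => by rw [← h, ← h, hij]

lemma IsHalfGraph.comp (h : IsHalfGraph G y s) {φ : ℕ → ℕ} (hφ : StrictMono φ) :
    IsHalfGraph G (y ∘ φ) (s ∘ φ) :=
  fun _ _ => (h _ _).trans hφ.lt_iff_lt

lemma IsHalfGraph.trans (hgem : IsFree coGem G) (hP5 : IsFree (P 5) G) (hzy : IsHalfGraph G z y)
    (hys : IsHalfGraph G y s) (hy : ∀ i j, ¬ G.Adj (y i) (y j)) :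
    IsHalfGraph G (z ∘ (2 * · + 1)) (s ∘ (2 * · + 1)) := by
  have hsy (i j : ℕ) : G.Adj (s i) (y j) ↔ j < i := (G.adj_comm _ _).trans (hys j i)
  have adj_of_lt {i j : ℕ} (hij : i + 1 < j) : G.Adj (z i) (s j) := by
    refine hP5.adj_of_crossing hy (i := i + 1) (j := j) (l := i) ?_ ?_ ?_ ?_ ?_ ?_ <;>
      simp only [hzy _ _, hsy] <;> lia
  have not_adj_of_le {i j : ℕ} (hj : 0 < j) (hji : j ≤ i) : ¬ G.Adj (z i) (s j) := by
    refine hgem.not_adj_of_private_neighbors hy (i := i + 1) (j := 0) (l := i) ?_ ?_ ?_ ?_ ?_ ?_ <;>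
      simp only [hzy _ _, hsy] <;> lia
  refine fun i j => ⟨fun h => ?_, fun h => adj_of_lt (by lia)⟩
  by_contra! hji
  exact not_adj_of_le (by lia) (by lia) h

lemma exists_isHalfGraph {ι : Type*} (hP5 : IsFree (P 5) G) (hG : G.CliqueFree n)
    {Q : ℕ → ι → V} (hQ : IsCliqueFamily G Q)
    (h : ∀ T : Set ℕ, T.Infinite →
      ∃ i ∈ T, ∃ a y, ¬ G.Adj y (Q i a) ∧ {j ∈ T | ∀ b, G.Adj y (Q j b)}.Infinite) :
    ∃ (φ : ℕ → ℕ) (a : ℕ → ι) (z : ℕ → V), StrictMono φ ∧ (∀ i j, ¬ G.Adj (z i) (z j)) ∧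
      IsHalfGraph G z fun t => Q (φ t) (a t) := by
  obtain ⟨φ, p, hφ, hp⟩ := exists_strictMono_of_forall_infinite
    (R := fun (p : V × ι) i j => ¬ G.Adj p.1 (Q i p.2) ∧ ∀ b, G.Adj p.1 (Q j b)) fun T hT => by
      obtain ⟨i, hi, a, y, hya, hy⟩ := h T hT
      exact ⟨i, hi, (y, a), hy.mono fun j hj => ⟨hj.1, hya, hj.2⟩⟩
  obtain ⟨σ, hσ, hind⟩ := exists_strictMono_not_adj hG fun t => (p t).1
  have hadj {i j : ℕ} (hij : i < j) : G.Adj (p (σ i)).1 (Q (φ (σ j)) (p (σ j)).2) :=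
    (hp _ _ (hσ hij)).2 _
  have hself (i : ℕ) : ¬ G.Adj (p (σ i)).1 (Q (φ (σ i)) (p (σ i)).2) :=
    (hp _ _ (Nat.lt_succ_self _)).1
  refine ⟨φ ∘ σ, fun t => (p (σ t)).2, fun t => (p (σ t)).1, hφ.comp hσ, hind, fun i j =>
    ⟨fun hij => ?_, hadj⟩⟩
  by_contra! hji
  rcases hji.lt_or_eq with hji | rfl
  · have htransversal := (hQ.comp (hφ.comp hσ).injective Function.injective_id).not_adj_transversal
      fun t => (p (σ t)).2
    exact hind i j (hP5.adj_of_crossing htransversal (i := i + 1) (hadj (Nat.lt_succ_self i))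
      (hadj (hji.trans (Nat.lt_succ_self i))) hij (hself j) (hself i) (hadj hji))
  · exact hself j hij

lemma exists_induced_matching_or_isHalfGraph (hgem : IsFree coGem G) (hP5 : IsFree (P 5) G)
    (hG : G.CliqueFree n) (hU : IsUndominated G) (hs : Function.Injective s)
    (hind : ∀ i j, ¬ G.Adj (s i) (s j)) :
    (∃ Q : ℕ → Fin 2 → V, IsCliqueFamily G Q) ∨
      ∃ (φ : ℕ → ℕ) (z : ℕ → V), StrictMono φ ∧ (∀ i j, ¬ G.Adj (z i) (z j)) ∧
        IsHalfGraph G z (s ∘ φ) := by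
  rw [or_iff_not_imp_left]
  intro hmatching
  have hQ : IsCliqueFamily G fun i (_ : Unit) => s i := fun i j _ _ => by simp [hind]
  obtain ⟨φ, -, z, hφ, hz, hzs⟩ := exists_isHalfGraph hP5 hG hQ fun T hT => by
    by_contra! hfin
    have := hT.to_subtype
    obtain ⟨Q, hQ⟩ := exists_isCliqueFamily_fin_two hgem hP5 hU (s := fun j : T => s j)
      (hs.comp Subtype.val_injective) (fun _ _ => hind _ _) fun y i hy =>
        ((hfin i i.2 () y hy).preimage Subtype.val_injective.injOn).subset
          fun j hj => ⟨j.2, fun _ => hj⟩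
    exact hmatching ⟨_, hQ.comp (Infinite.natEmbedding T).injective Function.injective_id⟩
  exact ⟨φ, z, hφ, hz, hzs⟩

lemma exists_halfGraph_chain [Infinite V] (hgem : IsFree coGem G) (hP5 : IsFree (P 5) G)
    (hG : G.CliqueFree n) (hU : IsUndominated G)
    (hmatching : ¬ ∃ Q : ℕ → Fin 2 → V, IsCliqueFamily G Q) (d : ℕ) :
    ∃ L : Fin (d + 1) → ℕ → V, Function.Injective (L 0) ∧ (∀ i j, ¬ G.Adj (L 0 i) (L 0 j)) ∧
      ∀ a b, a < b → IsHalfGraph G (L a) (L b) := by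
  induction d with
  | zero =>
    let v := Infinite.natEmbedding V
    obtain ⟨φ, hφ, hind⟩ := exists_strictMono_not_adj hG v
    exact ⟨fun _ => v ∘ φ, v.injective.comp hφ.injective, hind, fun a b hab => by lia⟩
  | succ d ih =>
    obtain ⟨L, hinj, hind, hL⟩ := ih
    obtain ⟨φ, z, hφ, hz, hzL⟩ :=
      (exists_induced_matching_or_isHalfGraph hgem hP5 hG hU hinj hind).resolve_left hmatching
    have hodd : StrictMono fun i : ℕ => 2 * i + 1 := fun _ _ hij => by dsimp only; lia
    refine ⟨Fin.cons (z ∘ (2 * · + 1)) fun a => L a ∘ φ ∘ (2 * · + 1),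
      hzL.injective.comp hodd.injective, fun _ _ => hz _ _, fun a b hab => ?_⟩
    cases b using Fin.cases with
    | zero => exact (Fin.not_lt_zero a hab).elim
    | succ b =>
      cases a using Fin.cases with
      | succ a => exact (hL a b (Fin.succ_lt_succ_iff.1 hab)).comp (hφ.comp hodd)
      | zero =>
        rcases eq_or_ne b 0 with rfl | hb
        · exact hzL.comp hodd
        · exact hzL.trans hgem hP5 ((hL 0 b (Fin.pos_of_ne_zero hb)).comp hφ) fun _ _ => hind _ _

lemma exists_infinite_induced_matching [Infinite V] (hgem : IsFree coGem G) (hP5 : IsFree (P 5) G)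
    (hG : G.CliqueFree n) (hU : IsUndominated G) :
    ∃ Q : ℕ → Fin 2 → V, IsCliqueFamily G Q := by
  by_contra hmatching
  obtain ⟨L, -, -, hL⟩ := exists_halfGraph_chain hgem hP5 hG hU hmatching n
  refine not_cliqueFree_of_pairwise_adj (f := fun a : Fin n => L a.castSucc a) ?_ hG
  exact Pairwise.of_lt fun a b hab => (hL _ _ (Fin.castSucc_lt_castSucc_iff.2 hab) _ _).2 hab

end HalfGraphs

section Enlargement

variable {V κ ι : Type*} {G : SimpleGraph V} {n c : ℕ} {Q : κ → ι → V} {x : V} {i j : κ}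

lemma IsCliqueFamily.adj_of_mixed (hgem : IsFree coGem G) (hQ : IsCliqueFamily G Q) {l : κ}
    {a b e : ι} (hij : i ≠ j) (hil : i ≠ l) (hjl : j ≠ l) (ha : G.Adj x (Q i a))
    (hb : ¬ G.Adj x (Q i b)) (he : G.Adj x (Q j e)) (d : ι) : G.Adj x (Q l d) := by
  by_contra hd
  have hba : b ≠ a := by rintro rfl; exact hb ha
  exact hgem.false_of_path_four_add_vertex (hQ.adj i hba) ha.symm he (mt G.adj_symm hb)
    (hQ.not_adj hij _ _) (hQ.not_adj hij _ _) (hQ.not_adj hil _ _) (hQ.not_adj hil _ _) hd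
    (hQ.not_adj hjl _ _)

lemma IsCliqueFamily.encard_not_complete_le [Nontrivial ι] (hgem : IsFree coGem G)
    (hP3 : IsFree (P3PlusCopiesP2 c) G) (hQ : IsCliqueFamily G Q) {a e : ι} (hij : i ≠ j)
    (ha : G.Adj x (Q i a)) (he : G.Adj x (Q j e)) :
    {l | ∃ d, ¬ G.Adj x (Q l d)}.encard ≤ (c + 2 : ℕ) := by
  by_cases hmixed : ∃ l b d, G.Adj x (Q l b) ∧ ¬ G.Adj x (Q l d)
  · obtain ⟨l, b, d, hb, hd⟩ := hmixed
    obtain ⟨m, e', hlm, he'⟩ : ∃ m e', l ≠ m ∧ G.Adj x (Q m e') := by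
      rcases eq_or_ne l i with rfl | hli
      exacts [⟨j, e, hij, he⟩, ⟨i, a, hli, ha⟩]
    have hsub : {l | ∃ d, ¬ G.Adj x (Q l d)} ⊆ {l, m} := by
      rintro l' ⟨d', hd'⟩
      by_contra! hl'
      simp only [Set.mem_insert_iff, Set.mem_singleton_iff, not_or] at hl'
      exact hd' (hQ.adj_of_mixed hgem hlm (Ne.symm hl'.1) (Ne.symm hl'.2) hb hd he' d')
    calc _ ≤ ({l, m} : Set κ).encard := Set.encard_le_encard hsub
      _ = 2 := Set.encard_pair hlm
      _ ≤ _ := by exact_mod_cast Nat.le_add_left 2 c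
  · push Not at hmixed
    have hsub : {l | ∃ d, ¬ G.Adj x (Q l d)} ⊆
        {l | ∀ d, ¬ G.Adj (Q i a) (Q l d) ∧ ¬ G.Adj x (Q l d) ∧ ¬ G.Adj (Q j e) (Q l d)} := by
      rintro l ⟨d', hd'⟩ d
      have hl (b : ι) : ¬ G.Adj x (Q l b) := fun hb => hd' (hmixed l b d' hb)
      exact ⟨hQ.not_adj (by rintro rfl; exact hl a ha) _ _, hl d,
        hQ.not_adj (by rintro rfl; exact hl e he) _ _⟩
    calc _ ≤ _ := Set.encard_le_encard hsub
      _ ≤ (c : ℕ∞) := (hP3.encard_lt_of_isCliqueFamily hQ ha.symm he (hQ.not_adj hij _ _)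
        (hQ.ne hij _ _)).le
      _ ≤ _ := by exact_mod_cast Nat.le_add_right c 2

lemma IsCliqueFamily.adj_of_forall_ne_not_adj [Infinite κ] [Nontrivial ι]
    (hP3 : IsFree (P3PlusCopiesP2 c) G) (hQ : IsCliqueFamily G Q)
    (hx : ∀ l, l ≠ i → ∀ d, ¬ G.Adj x (Q l d)) (hne : ∀ b, x ≠ Q i b) {a : ι}
    (ha : G.Adj x (Q i a)) (b : ι) : G.Adj x (Q i b) := by
  by_contra hb
  have hab : a ≠ b := by rintro rfl; exact hb ha
  have hlt := hP3.encard_lt_of_isCliqueFamily hQ ha (hQ.adj i hab) hb (hne b)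
  have hinf : {l | ∀ d, ¬ G.Adj x (Q l d) ∧ ¬ G.Adj (Q i a) (Q l d) ∧
      ¬ G.Adj (Q i b) (Q l d)}.Infinite :=
    (Set.finite_singleton i).infinite_compl.mono fun l hl d =>
      ⟨hx l hl d, hQ.not_adj (Ne.symm hl) _ _, hQ.not_adj (Ne.symm hl) _ _⟩
  exact not_top_lt (hinf.encard_eq ▸ hlt)

lemma IsCliqueFamily.exists_private_or_exists_almost_complete {ι : Type} [Finite ι]
    [Nontrivial ι] [Infinite κ] (hgem : IsFree coGem G) (hP3 : IsFree (P3PlusCopiesP2 c) G)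
    (hU : IsUndominated G) {Q : κ → ι → V} (hQ : IsCliqueFamily G Q) (hij : i ≠ j) :
    (∃ x, ∀ l b, G.Adj x (Q l b) ↔ l = j) ∨
      ∃ x a, ¬ G.Adj x (Q i a) ∧ {l | ∃ d, ¬ G.Adj x (Q l d)}.Finite := by
  obtain ⟨a, x, hxj, hxa, hxi⟩ := hU ι (Q j) (Q i)
    (fun a b hab => hQ.adj i ((hQ j j a b).1 hab).2) fun a b => hQ.ne hij.symm a b
  by_cases hother : ∃ l, l ≠ j ∧ ∃ d, G.Adj x (Q l d)
  · obtain ⟨l, hl, d, hd⟩ := hother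
    exact .inr ⟨x, a, hxi,
      Set.finite_of_encard_le_coe (hQ.encard_not_complete_le hgem hP3 hl hd hxa)⟩
  · push Not at hother
    refine .inl ⟨x, fun l b => ⟨fun h => ?_, ?_⟩⟩
    · by_contra hl
      exact hother l hl b h
    · rintro rfl
      exact hQ.adj_of_forall_ne_not_adj hP3 hother (fun b hb => hxj ⟨b, hb.symm⟩) hxa b

lemma IsCliqueFamily.not_isHalfGraph [Nontrivial ι] (hgem : IsFree coGem G)
    (hP3 : IsFree (P3PlusCopiesP2 c) G) {Q : ℕ → ι → V} (hQ : IsCliqueFamily G Q) {a : ℕ → ι}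
    {z : ℕ → V} : ¬ IsHalfGraph G z fun t => Q t (a t) := by
  intro h
  have hle := hQ.encard_not_complete_le hgem hP3 (x := z (c + 2)) (i := c + 3) (j := c + 4)
    (by lia) ((h _ _).2 (by lia)) ((h _ _).2 (by lia))
  have hsub : (Finset.range (c + 3) : Set ℕ) ⊆ {l | ∃ d, ¬ G.Adj (z (c + 2)) (Q l d)} :=
    fun l hl => ⟨a l, fun hadj => by
      have := (h _ _).1 hadj
      simp only [Finset.coe_range, Set.mem_Iio] at hl
      lia⟩
  have hcard := (Set.encard_le_encard hsub).trans hle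
  rw [Set.encard_coe_eq_coe_finsetCard, Finset.card_range, Nat.cast_le] at hcard
  lia

lemma IsCliqueFamily.exists_enlargement (hgem : IsFree coGem G) (hP5 : IsFree (P 5) G)
    (hP3 : IsFree (P3PlusCopiesP2 c) G) (hG : G.CliqueFree n) (hU : IsUndominated G) {p : ℕ}
    {Q : ℕ → Fin (p + 2) → V} (hQ : IsCliqueFamily G Q) :
    ∃ Q' : ℕ → Fin (p + 3) → V, IsCliqueFamily G Q' := by
  let J : Set ℕ := {j | ∃ x, ∀ l b, G.Adj x (Q l b) ↔ l = j}
  by_cases hJ : J.Infinite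
  · have hφ := (Nat.nth_strictMono hJ).injective
    choose x hx using Nat.nth_mem_of_infinite hJ
    exact ⟨_, (hQ.comp hφ Function.injective_id).cons hgem (x := x) fun i j b =>
      (hx i _ b).trans (hφ.eq_iff.trans eq_comm)⟩
  · exfalso
    obtain ⟨φ, a, z, hφ, -, hz⟩ := exists_isHalfGraph hP5 hG hQ fun T hT => by
      have hTJ : (T \ J).Infinite := hT.sdiff (Set.not_infinite.1 hJ)
      obtain ⟨i, hi⟩ := hTJ.nonempty
      obtain ⟨j, hj, hij⟩ := hTJ.exists_gt i
      obtain ⟨x, a, hxi, hfin⟩ :=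
        (hQ.exists_private_or_exists_almost_complete hgem hP3 hU hij.ne).resolve_left hj.2
      exact ⟨i, hi.1, a, x, hxi, (hT.sdiff hfin).mono fun l hl =>
        ⟨hl.1, fun b => not_not.1 fun hb => hl.2 ⟨b, hb⟩⟩⟩
    exact (hQ.comp hφ.injective Function.injective_id).not_isHalfGraph hgem hP3 hz

lemma finite_of_isUndominated (hgem : IsFree coGem G) (hP5 : IsFree (P 5) G)
    (hP3 : IsFree (P3PlusCopiesP2 c) G) (hG : G.CliqueFree n) (hU : IsUndominated G) :
    Finite V := by
  by_contra hV
  rw [not_finite_iff_infinite] at hV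
  have hcliques (p : ℕ) : ∃ Q : ℕ → Fin (p + 2) → V, IsCliqueFamily G Q := by
    induction p with
    | zero => exact exists_infinite_induced_matching hgem hP5 hG hU
    | succ p ih =>
      obtain ⟨Q, hQ⟩ := ih
      exact hQ.exists_enlargement hgem hP5 hP3 hG hU
  obtain ⟨Q, hQ⟩ := hcliques n
  exact not_cliqueFree_of_pairwise_adj (f := Q 0) (fun _ _ => hQ.adj 0) (hG.mono (by lia))

end Enlargement

section Ultraproduct

variable {α : Type*} {V : α → Type*} {U : Ultrafilter α} {G : ∀ i, SimpleGraph (V i)}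

/-- The ultraproduct of the graphs `G i` along `U`: two classes are adjacent when their
representatives are adjacent in `U`-almost every factor. Since `U`-equivalent representatives give
the same relation, the one chosen by `Quotient.out` is used. -/
def ultraproduct (U : Ultrafilter α) (G : ∀ i, SimpleGraph (V i)) :
    SimpleGraph ((U : Filter α).Product V) where
  Adj x y := ∀ᶠ i in U, (G i).Adj (x.out i) (y.out i)
  symm := ⟨fun _ _ h => h.mono fun _ hi => hi.symm⟩
  loopless := ⟨fun _ h => h.exists.elim fun i => (G i).irrefl⟩

lemma eventually_out_ne {x y : (U : Filter α).Product V} (h : x ≠ y) :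
    ∀ᶠ i in U, x.out i ≠ y.out i :=
  Ultrafilter.eventually_not.2 fun hxy => h (Quotient.out_equiv_out.1 hxy)

lemma exists_eventually_out [∀ i, Nonempty (V i)] {p : ∀ i, V i → Prop}
    (h : ∀ᶠ i in U, ∃ v, p i v) : ∃ y : (U : Filter α).Product V, ∀ᶠ i in U, p i (y.out i) := by
  obtain ⟨x, hx⟩ := skolem.1 h
  refine ⟨Quotient.mk _ x, ?_⟩
  filter_upwards [hx, Quotient.mk_out (s := productSetoid (U : Filter α) V) x] with i hi hyi
  exact hyi.symm ▸ hi

lemma eventually_comap_out_eq {W : Type*} [Finite W] (f : W → (U : Filter α).Product V) :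
    ∀ᶠ i in U, (G i).comap (fun a => (f a).out i) = (ultraproduct U G).comap f := by
  simp only [SimpleGraph.ext_iff, funext_iff, comap_adj, eq_iff_iff, eventually_all]
  intro a b
  by_cases h : (ultraproduct U G).Adj (f a) (f b)
  · exact h.mono fun i hi => iff_of_true hi h
  · exact (Ultrafilter.eventually_not.2 h).mono fun i hi => iff_of_false hi h

lemma IsFree.ultraproduct {W : Type*} [Finite W] {H : SimpleGraph W} (h : ∀ i, IsFree H (G i)) :
    IsFree H (ultraproduct U G) := by
  intro hcontained
  obtain ⟨e, he⟩ := isIndContained_iff_exists_comap_eq.1 hcontained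
  have hinj : ∀ᶠ i in U, ∀ a b, a ≠ b → (e a).out i ≠ (e b).out i := by
    simp only [eventually_all]
    exact fun a b hab => eventually_out_ne (e.injective.ne hab)
  obtain ⟨i, hi, hcomap⟩ := (hinj.and (eventually_comap_out_eq (G := G) e)).exists
  exact h i <| isIndContained_iff_exists_comap_eq.2
    ⟨⟨fun a => (e a).out i, fun a b => not_imp_not.1 (hi a b)⟩, hcomap.trans he⟩

lemma cliqueFree_ultraproduct {n : ℕ} (h : ∀ i, (G i).CliqueFree n) :
    (ultraproduct U G).CliqueFree n := by
  by_contra hclique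
  exact IsFree.ultraproduct (H := completeGraph (Fin n))
    (fun i hi => hi.isContained.not_cliqueFree (h i))
    (topEmbeddingOfNotCliqueFree hclique).isIndContained

lemma IsUndominated.ultraproduct (h : ∀ i, IsUndominated (G i)) :
    IsUndominated (ultraproduct U G) := by
  intro ι _ _ f g hfg hne
  have hdisj : ∀ᶠ i in U, ∀ a b, (f a).out i ≠ (g b).out i := by
    simp only [eventually_all]
    exact fun a b => eventually_out_ne (hne a b)
  have hwitness : ∀ᶠ i in U, ∃ a ∈ Set.univ, ∃ x ∉ Set.range fun b => (f b).out i,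
      (G i).Adj x ((f a).out i) ∧ ¬ (G i).Adj x ((g a).out i) := by
    filter_upwards [hdisj, eventually_comap_out_eq (G := G) f, eventually_comap_out_eq (G := G) g]
      with i hi hf hg
    obtain ⟨a, x, hx⟩ := h i ι _ _ (hf.trans_le (hfg.trans_eq hg.symm)) hi
    exact ⟨a, trivial, x, hx⟩
  obtain ⟨a, -, ha⟩ := (Ultrafilter.eventually_exists_mem_iff Set.finite_univ).1 hwitness
  have (i : α) : Nonempty (V i) := ⟨(f a).out i⟩
  obtain ⟨y, hy⟩ := exists_eventually_out ha
  refine ⟨a, y, ?_, hy.mono fun i hi => hi.2.1,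
    Ultrafilter.eventually_not.1 (hy.mono fun i hi => hi.2.2)⟩
  rintro ⟨b, rfl⟩
  obtain ⟨i, hi⟩ := hy.exists
  exact hi.1 ⟨b, rfl⟩

lemma infinite_product_of_tendsto_card [∀ i, Nonempty (V i)]
    (h : Tendsto (fun i => Nat.card (V i)) U atTop) : Infinite ((U : Filter α).Product V) := by
  have hfun (i : α) : ∃ x : ℕ → V i, Set.InjOn x (Set.Iio (Nat.card (V i))) := by
    have hle : (Set.Iio (Nat.card (V i))).encard ≤ (Set.univ : Set (V i)).encard := by
      simpa [Set.encard_eq_coe_toFinset_card] using Set.ncard_le_encard (Set.univ : Set (V i))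
    obtain ⟨x, -, hx⟩ := (Set.finite_Iio _).exists_injOn_of_encard_le hle
    exact ⟨x, hx⟩
  choose x hx using hfun
  refine Infinite.of_injective (fun m => Quotient.mk _ fun i => x i m) fun l m hlm => ?_
  obtain ⟨i, hi, hlarge⟩ :=
    (Eventually.and (Quotient.exact hlm) (h.eventually_gt_atTop (max l m))).exists
  exact hx i (lt_of_le_of_lt (le_max_left _ _) hlarge) (lt_of_le_of_lt (le_max_right _ _) hlarge) hi

end Ultraproduct

lemma exists_natCard_le (n c : ℕ) : ∃ N : ℕ, ∀ (V : Type*) (G : SimpleGraph V),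
    IsUndominated G → G.CliqueFree n → IsFree coGem G → IsFree (P 5) G →
      IsFree (P3PlusCopiesP2 c) G → Nat.card V ≤ N := by
  by_contra! hunbounded
  choose V G hU hG hgem hP5 hP3 hcard using hunbounded
  have (N : ℕ) : Nonempty (V N) := (Nat.card_pos_iff.1 (Nat.zero_lt_of_lt (hcard N))).1
  have hinf : Infinite ((hyperfilter ℕ : Filter ℕ).Product V) :=
    infinite_product_of_tendsto_card <|
      (tendsto_atTop_mono (fun N => (hcard N).le) tendsto_id).mono_left Nat.hyperfilter_le_atTop
  have hfin := finite_of_isUndominated (G := ultraproduct (hyperfilter ℕ) G) (.ultraproduct hgem)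
    (.ultraproduct hP5) (.ultraproduct hP3) (cliqueFree_ultraproduct hG) (.ultraproduct hU)
  exact not_finite_iff_infinite.2 hinf hfin

end VertexCritical

theorem theorem3p1_general (n c : ℕ) :
    ∃ F : Finset (Σ m : ℕ, SimpleGraph (Fin m)),
      ∀ (V : Type*) (G : SimpleGraph V),
        VertexCritical.IsUndominated G →
        G.CliqueFree n →
        VertexCritical.IsFree VertexCritical.coGem G →
        VertexCritical.IsFree (VertexCritical.P 5) G →
        VertexCritical.IsFree (VertexCritical.P3PlusCopiesP2 c) G →
        ∃ H ∈ F, Nonempty (G ≃g H.2) := by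
  classical
  obtain ⟨N, hN⟩ := VertexCritical.exists_natCard_le n c
  refine ⟨(Finset.range (N + 1)).sigma fun _ => Finset.univ, fun V G hU hG hgem hP5 hP3 => ?_⟩
  have := VertexCritical.finite_of_isUndominated hgem hP5 hP3 hG hU
  have := Fintype.ofFinite V
  have hcard : Fintype.card V ≤ N := Nat.card_eq_fintype_card (α := V) ▸ hN V G hU hG hgem hP5 hP3
  exact ⟨⟨_, G.overFin rfl⟩, by simpa [Nat.lt_succ_iff] using hcard, ⟨G.overFinIso rfl⟩⟩

theorem theorem3p1 (k c : ℕ) (hk : 1 ≤ k) :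
    ∃ F : Finset (Σ n : ℕ, SimpleGraph (Fin n)),
      ∀ (V : Type*) [Finite V] (G : SimpleGraph V),
        VertexCritical.IsVertexCritical G k →
        VertexCritical.IsFree VertexCritical.coGem G →
        VertexCritical.IsFree (VertexCritical.P 5) G →
        VertexCritical.IsFree (VertexCritical.P3PlusCopiesP2 c) G →
        ∃ H ∈ F, Nonempty (G ≃g H.2) := by
  obtain ⟨F, hF⟩ := theorem3p1_general (k + 1) c
  exact ⟨F, fun V _ G hcrit => hF V G hcrit.isUndominated hcrit.cliqueFree⟩
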